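/- **Lemma (Coercivity of the viscous bilinear form).** Let $d\in\{2,3\}$ and $m\ge 0$. Let $\mathcal T_h$ be a conforming mesh (finitely many non-overlapping convex polytopes, e.g. simplices, no hanging nodes) of an open polytopal set $\Omega\subset\mathbb R^d$, with set of faces $\mathcal F_h$; write $\mathcal F_K$ for the faces (facets) of an element $K$, and $h_K$, $h_F$ for the diameters of $K$ and of a face $F$. On an interior face, shared by the elements $K_+$ and $K_-$, let $n_F$ be the unit normal pointing from $K_+$ to $K_-$, $[\![w]\!]=w_+-w_-$ and $\{\!\{S\}\!\}=\tfrac12(S_++S_-)$; on a boundary face $n_F$ is the outward unit normal and $[\![w]\!]=w$, $\{\!\{S\}\!\}=S$. For a piecewise polynomial vector field $w$ put $$S_h(w)=\nabla_h w+\nabla_h w^T-\tfrac23(\nabla_h\cdot w)\,\mathbb I ,$$ and for a penalty parameter $\eta$ define $$a_h(v,w)=\sum_{K}\int_K S_h(v):\nabla_h w\,dV-\sum_{F}\int_F[\![v]\!]\cdot\{\!\{S_h(w)\}\!\}n_F\,dA-\sum_{F}\int_F[\![w]\!]\cdot\{\!\{S_h(v)\}\!\}n_F\,dA+\sum_{F}\int_F\frac{\eta}{h_F}[\![v]\!]\cdot[\![w]\!]\,dA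 ,$$ $$|||w|||_{\rm sym}=\Big(\sum_K\int_K|S_h(w)|^2\,dV+\sum_F\int_F\frac1{h_F}\big|[\![w]\!]\big|^2\,dA\Big)^{1/2},$$ sums being over $K\in\mathcal T_h$ and $F\in\mathcal F_h$. Call $C_{\rm tr}$ a discrete trace constant of $\mathcal T_h$ (for degree $m$) if $h_K^{1/2}\|p\|_{L^2(F)}\le C_{\rm tr}\|p\|_{L^2(K)}$ for all $K\in\mathcal T_h$, $F\in\mathcal F_K$ and all polynomials $p$ of degree at most $m$. 1. For every $\rho$ there is a constant $C_{\rm tr}>0$, depending only on $d$, $m$ and $\rho$, which is a discrete trace constant of every mesh $\mathcal T_h$ each of whose elements $K$ contains a ball of some radius $r_K>0$ with $h_K\le\rho\,r_K$. 2. Let $C_{\rm tr}$ and $\eta$ be real numbers and $N_\partial$ a natural number with $\eta>2C_{\rm tr}^2N_\partial$, and let $C=\dfrac{\eta-2C_{\rm tr}^2N_\partial}{1+2\eta}$. Then $C>0$, and for every mesh $\mathcal T_h$ that has $C_{\rm tr}$ as a discrete trace constant and whose elements have at most $N_\partial$ faces each, and for every space $W_h$ of piecewise polynomial vector fields of degree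 at most $m$ on $\mathcal T_h$ (in particular for every such $W_h\subset H_0(\mathrm{div};\Omega)$), $$a_h(w_h,w_h)\ \ge\ C\,|||w_h|||_{\rm sym}^2\qquad\text{for all }w_h\in W_h .$$ In particular $C$ does not depend on $h$. -/

import Mathlib

open MeasureTheory
open scoped RealInnerProductSpace

noncomputable section

namespace ViscousDG

/-- The Euclidean space `ℝᵈ`. -/
abbrev E (d : ℕ) := EuclideanSpace ℝ (Fin d)

/-- A convex polytope with nonempty interior (for instance a triangle or a tetrahedron). -/
def IsSolidPolytope {d : ℕ} (K : Set (E d)) : Prop :=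
  (∃ s : Set (E d), s.Finite ∧ K = convexHull ℝ s) ∧ (interior K).Nonempty

/-- `F` is a facet (an edge if `d = 2`, a planar face if `d = 3`) of the convex set `K`: a nonempty
exposed face of dimension `d - 1`. -/
def IsFacet {d : ℕ} (K F : Set (E d)) : Prop :=
  F.Nonempty ∧ IsExposed ℝ K F ∧ Module.finrank ℝ (vectorSpan ℝ F) + 1 = d

/-- A conforming mesh (no hanging nodes) of `Ω ⊆ ℝᵈ` by convex polytopes, together with a choice of
a positive and a negative side for each interior face. -/
structure Mesh (d : ℕ) (Ω : Set (E d)) where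
  /-- the collection of elements -/
  elems : Finset (Set (E d))
  isSolidPolytope : ∀ K ∈ elems, IsSolidPolytope K
  isOpen : IsOpen Ω
  closure_eq : closure Ω = ⋃ K ∈ elems, K
  nonoverlap : ∀ K ∈ elems, ∀ K' ∈ elems, K ≠ K' → Disjoint (interior K) (interior K')
  /-- No hanging nodes: two elements meet in a common face (possibly of low dimension or empty). -/
  conforming : ∀ K ∈ elems, ∀ K' ∈ elems, IsExposed ℝ K (K ∩ K')
  /-- the collection of all faces of elements -/
  faces : Finset (Set (E d))
  mem_faces : ∀ F, F ∈ faces ↔ ∃ K ∈ elems, IsFacet K F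
  /-- the element on the positive side of a face; for a boundary face, its only element -/
  plus : {F // F ∈ faces} → {K // K ∈ elems}
  /-- the element on the negative side of an interior face; `none` for a boundary face -/
  minus : {F // F ∈ faces} → Option {K // K ∈ elems}
  isFacet_iff : ∀ F K, IsFacet K.1 F.1 ↔ (K = plus F ∨ minus F = some K)
  minus_ne_plus : ∀ F, minus F ≠ some (plus F)
  frontier_eq : frontier Ω = ⋃ (F : {F // F ∈ faces}) (_ : minus F = none), F.1
  /-- the unit normal of a face, pointing out of its positive side -/
  normal : {F // F ∈ faces} → E d
  norm_normal : ∀ F, ‖normal F‖ = 1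
  normal_outward : ∀ F, ∀ x ∈ F.1, ∀ y ∈ (plus F).1, ⟪normal F, y - x⟫ ≤ 0

namespace Mesh

variable {d : ℕ} {Ω : Set (E d)} (T : Mesh d Ω)

/-- The elements of the mesh, as a type. -/
abbrev Elem := {K // K ∈ T.elems}

/-- The faces of the mesh, as a type. -/
abbrev Face := {F // F ∈ T.faces}

open Classical in
/-- The number of faces of an element `K`. -/
def numFaces (K : T.Elem) : ℕ := (T.faces.filter (fun F => IsFacet K.1 F)).card

/-- Shape regularity: each element `K` contains a ball of radius `r` with `h_K ≤ ρ r`, where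
`h_K` is the diameter of `K`. -/
def IsShapeRegular (ρ : ℝ) : Prop :=
  ∀ K : T.Elem, ∃ (x : E d) (r : ℝ), 0 < r ∧ Metric.closedBall x r ⊆ K.1 ∧
    Metric.diam K.1 ≤ ρ * r

/-- `Ctr` is a constant of the discrete trace inequality
`h_K^{1/2} ‖p‖_{L²(F)} ≤ Ctr ‖p‖_{L²(K)}` for polynomials `p` of degree at most `m`, elements `K`
of the mesh and faces `F` of `K`. `μHE[d - 1]` is the `(d - 1)`-dimensional surface measure. -/
def IsDiscreteTraceConst (m : ℕ) (Ctr : ℝ) : Prop :=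
  ∀ (K : T.Elem) (F : T.Face), IsFacet K.1 F.1 →
    ∀ p : MvPolynomial (Fin d) ℝ, p.totalDegree ≤ m →
      √(Metric.diam K.1) * √(∫ x in F.1, (MvPolynomial.eval (fun i => x i) p) ^ 2 ∂μHE[d - 1])
        ≤ Ctr * √(∫ x in K.1, (MvPolynomial.eval (fun i => x i) p) ^ 2)

/-- Piecewise defined vector fields: a field `w K` for each element `K`, of which only the
restriction to the closed set `K` matters (its values on a face of `K` are the trace from `K`). -/
abbrev BrokenField := T.Elem → E d → E d

/-- The space of piecewise polynomial vector fields of degree at most `m`, without any continuity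
between elements. -/
def brokenPoly (m : ℕ) : Submodule ℝ T.BrokenField where
  carrier := {w | ∀ (K : T.Elem) (i : Fin d), ∃ p : MvPolynomial (Fin d) ℝ,
    p.totalDegree ≤ m ∧ ∀ x ∈ K.1, w K x i = MvPolynomial.eval (fun j => x j) p}
  zero_mem' := fun K i => ⟨0, by simp, by simp⟩
  add_mem' := by
    intro v w hv hw K i
    obtain ⟨p, hp, hpv⟩ := hv K i
    obtain ⟨q, hq, hqw⟩ := hw K i
    exact ⟨p + q, (MvPolynomial.totalDegree_add p q).trans (max_le hp hq),
      fun x hx => by simp [hpv x hx, hqw x hx]⟩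
  smul_mem' := by
    intro c w hw K i
    obtain ⟨p, hp, hpw⟩ := hw K i
    exact ⟨c • p, (MvPolynomial.totalDegree_smul_le c p).trans hp,
      fun x hx => by simp [hpw x hx, MvPolynomial.smul_eval]⟩

variable {T}

/-- The broken gradient: `(∇_h w)_{ij} = ∂_j w_i` on the element `K` (up to the boundary). -/
def grad (w : T.BrokenField) (K : T.Elem) (x : E d) : Matrix (Fin d) (Fin d) ℝ :=
  Matrix.of fun i j => (fderivWithin ℝ (w K) K.1 x (EuclideanSpace.single j 1)) i

/-- The broken divergence. -/
def divergence (w : T.BrokenField) (K : T.Elem) (x : E d) : ℝ := (grad w K x).trace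

/-- The tensor `∇_h w + ∇_h wᵀ - (2/3) (∇_h · w) 𝕀`. -/
def stress (w : T.BrokenField) (K : T.Elem) (x : E d) : Matrix (Fin d) (Fin d) ℝ :=
  grad w K x + (grad w K x).transpose - ((2 / 3 : ℝ) * divergence w K x) • 1

/-- The jump `w₊ - w₋` across an interior face; the trace of `w` on a boundary face. -/
def jump (w : T.BrokenField) (F : T.Face) (x : E d) : E d :=
  match T.minus F with
  | none => w (T.plus F) x
  | some K => w (T.plus F) x - w K x

/-- The average of the stress tensor on a face (its trace on a boundary face). -/
def avgStress (w : T.BrokenField) (F : T.Face) (x : E d) : Matrix (Fin d) (Fin d) ℝ :=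
  match T.minus F with
  | none => stress w (T.plus F) x
  | some K => (1 / 2 : ℝ) • (stress w (T.plus F) x + stress w K x)

/-- The vector `{{∇_h w + ∇_h wᵀ - (2/3) (∇_h · w) 𝕀}} n_F` on a face. -/
def avgTraction (w : T.BrokenField) (F : T.Face) (x : E d) : E d :=
  WithLp.toLp 2 ((avgStress w F x).mulVec (WithLp.ofLp (T.normal F)))

/-- The Frobenius product `A : B`. -/
def frob (A B : Matrix (Fin d) (Fin d) ℝ) : ℝ := ∑ i, ∑ j, A i j * B i j

/-- The symmetric interior penalty viscous bilinear form `a_h` with penalty parameter `η`;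
the face size `h_F` is the diameter of `F`. -/
def viscousForm (η : ℝ) (v w : T.BrokenField) : ℝ :=
  (∑ K : T.Elem, ∫ x in K.1, frob (stress v K x) (grad w K x))
  - (∑ F : T.Face, ∫ x in F.1, ⟪jump v F x, avgTraction w F x⟫ ∂μHE[d - 1])
  - (∑ F : T.Face, ∫ x in F.1, ⟪jump w F x, avgTraction v F x⟫ ∂μHE[d - 1])
  + (∑ F : T.Face, ∫ x in F.1, (η / Metric.diam F.1) * ⟪jump v F x, jump w F x⟫ ∂μHE[d - 1])

/-- The norm `|||w|||_sym`. -/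
def symNorm (w : T.BrokenField) : ℝ :=
  √((∑ K : T.Elem, ∫ x in K.1, frob (stress w K x) (stress w K x))
    + (∑ F : T.Face, ∫ x in F.1,
        (1 / Metric.diam F.1) * ⟪jump w F x, jump w F x⟫ ∂μHE[d - 1]))

end Mesh

end ViscousDG

end

open ViscousDG

/-! Trace constant: a facet `F` of a convex body `K` and the centre `z` of an inscribed ball of
radius `r` span a cone in `K` of height at least `r`. On each segment from `z` to `F` a polynomial
becomes one of a single variable, and its squared end value is bounded by its integral against the
cone's Jacobian `t ^ n`, `n = d - 1`, with a constant depending only on `m` and `n`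
(`exists_sq_eval_one_le_integral`). Integration over `F` (`lintegral_cone_le`) gives
`exists_trace_const`, and `h_K ≤ ρ r` turns `r` into `h_K`.

Coercivity: `S : ∇w ≥ |S|² / 2` pointwise (`half_frob_stress_le`), so only the two equal consistency
terms can be negative. Young's inequality with weight `ε h_F` bounds them by face integrals of the
stress and the jump part of the norm. The trace inequality moves the former to the elements, each
counted once per face, whence the factor `Ctr ^ 2 * N`. A single `ε` then leaves both parts of the
norm with coefficient at least `C` (`coercivity_const_le`). -/

/-! ### A weighted inequality in one variable, and integration over cones -/

open Polynomial in
/-- On polynomials of degree at most `m`, evaluation at `1` is bounded with respect to the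
`L²`-norm on `[0, 1]` with weight `t ^ n`. -/
theorem exists_sq_eval_one_le_integral (m n : ℕ) : ∃ C : ℝ, 0 < C ∧ ∀ q : ℝ[X], q.natDegree ≤ m →
    (q.eval 1) ^ 2 ≤ C * ∫ t in (0 : ℝ)..1, t ^ n * (q.eval t) ^ 2 := by
  let r : (Fin (m + 1) → ℝ) → ℝ → ℝ := fun c t => ∑ i, c i * t ^ (i : ℕ)
  let Q : (Fin (m + 1) → ℝ) → ℝ := fun c => ∫ t in (0 : ℝ)..1, t ^ n * (r c t) ^ 2
  have hr : Continuous fun z : (Fin (m + 1) → ℝ) × ℝ => r z.1 z.2 := by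
    simp only [r]; fun_prop
  have hrc (c) : Continuous (r c) := by simp only [r]; fun_prop
  have hQ : Continuous Q := by
    refine intervalIntegral.continuous_parametric_intervalIntegral_of_continuous' ?_ 0 1
    simp only [Function.uncurry_def]
    fun_prop
  have hQpos (c) (hc : c ≠ 0) : 0 < Q c := by
    refine intervalIntegral.integral_pos zero_lt_one (by fun_prop)
      (fun t ht => mul_nonneg (pow_nonneg ht.1.le _) (sq_nonneg _)) ?_
    by_contra! hzero
    let q : ℝ[X] := ∑ i : Fin (m + 1), monomial (i : ℕ) (c i)
    have hq : q = 0 := by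
      refine eq_zero_of_infinite_isRoot q ((Set.Ioo_infinite (zero_lt_one (α := ℝ))).mono ?_)
      intro t ht
      have h1 := hzero t ⟨ht.1.le, ht.2.le⟩
      have h2 : r c t ^ 2 ≤ 0 := by
        by_contra! h
        exact h1.not_gt (mul_pos (pow_pos ht.1 _) h)
      have h3 : r c t = 0 := by nlinarith [sq_nonneg (r c t)]
      simpa [IsRoot.def, q, eval_finsetSum, r] using h3
    refine hc (funext fun i => ?_)
    have := congrArg (fun q : ℝ[X] => q.coeff i) hq
    simpa [q, finsetSum_coeff, coeff_monomial, Fin.val_inj] using this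
  -- `Q` is a positive definite quadratic form in the coefficients, so its minimum on the compact
  -- unit sphere is positive and homogeneity extends the bound to all `c`.
  obtain ⟨c₀, hc₀, hmin⟩ := (isCompact_sphere (0 : Fin (m + 1) → ℝ) 1).exists_isMinOn
    (NormedSpace.sphere_nonempty.2 zero_le_one) hQ.continuousOn
  have hδ : 0 < Q c₀ := hQpos c₀ (by rintro rfl; simp at hc₀)
  have hscale (a : ℝ) (c) : Q (a • c) = a ^ 2 * Q c := by
    simp only [Q, r, ← intervalIntegral.integral_const_mul]
    congr 1; ext t
    simp only [Pi.smul_apply, smul_eq_mul, mul_assoc, ← Finset.mul_sum]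
    ring
  have hlow (c) : Q c₀ * ‖c‖ ^ 2 ≤ Q c := by
    rcases eq_or_ne c 0 with rfl | hc
    · simp [Q, r]
    have hn : ‖c‖ ≠ 0 := norm_ne_zero_iff.2 hc
    have h1 : ‖c‖⁻¹ • c ∈ Metric.sphere (0 : Fin (m + 1) → ℝ) 1 := by
      simp [norm_smul, hn]
    have h2 : Q c₀ ≤ Q (‖c‖⁻¹ • c) := hmin h1
    have h3 := hscale ‖c‖ (‖c‖⁻¹ • c)
    rw [smul_smul, mul_inv_cancel₀ hn, one_smul] at h3
    rw [h3, mul_comm]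
    gcongr
  refine ⟨(m + 1) ^ 2 / Q c₀, by positivity, fun q hq => ?_⟩
  let c : Fin (m + 1) → ℝ := fun i => q.coeff i
  have hqc (t) : q.eval t = r c t := by
    rw [eval_eq_sum_range' (Nat.lt_succ_of_le hq), Finset.sum_range]
  have h1 : |r c 1| ≤ (m + 1) * ‖c‖ := by
    simp only [r, one_pow, mul_one]
    refine (Finset.abs_sum_le_sum_abs _ _).trans ?_
    refine (Finset.sum_le_sum fun i _ => (norm_le_pi_norm c i)).trans ?_
    simp
  simp only [hqc]
  calc (r c 1) ^ 2 = |r c 1| ^ 2 := (sq_abs _).symm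
    _ ≤ ((m + 1) * ‖c‖) ^ 2 := by gcongr
    _ = (m + 1) ^ 2 / Q c₀ * (Q c₀ * ‖c‖ ^ 2) := by field_simp
    _ ≤ (m + 1) ^ 2 / Q c₀ * Q c := by gcongr; exact hlow c

/-- Scaling of the variable in a Lebesgue integral. -/
theorem lintegral_eq_mul_lintegral_comp_smul {V : Type*} [NormedAddCommGroup V]
    [NormedSpace ℝ V] [FiniteDimensional ℝ V] [MeasurableSpace V] [BorelSpace V]
    (μ : Measure V) [μ.IsAddHaarMeasure] {t : ℝ} (ht : 0 < t) (g : V → ENNReal) :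
    ∫⁻ v, g v ∂μ = ENNReal.ofReal (t ^ Module.finrank ℝ V) * ∫⁻ v, g (t • v) ∂μ := by
  have he : MeasurableEmbedding (fun v : V => t • v) :=
    (Homeomorph.smulOfNeZero t ht.ne').measurableEmbedding
  rw [← he.lintegral_map, Measure.map_addHaar_smul μ ht.ne', lintegral_smul_measure, smul_eq_mul,
    ← mul_assoc, ← ENNReal.ofReal_mul (by positivity),
    abs_of_pos (by positivity), mul_inv_cancel₀ (by positivity), ENNReal.ofReal_one, one_mul]

/-- Integration over a cone with apex the origin and base `{H} × B`. -/
theorem lintegral_cone_le {V : Type*} [NormedAddCommGroup V]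
    [NormedSpace ℝ V] [FiniteDimensional ℝ V] [MeasurableSpace V] [BorelSpace V]
    (μ : Measure V) [μ.IsAddHaarMeasure] {H : ℝ} (hH : 0 < H) {f : ℝ × V → ENNReal}
    (hf : Measurable f) {B : Set V} (hB : MeasurableSet B) {K : Set (ℝ × V)}
    (hK : MeasurableSet K) (hBK : ∀ t ∈ Set.Ioc (0 : ℝ) 1, ∀ y ∈ B, (t * H, t • y) ∈ K) :
    ENNReal.ofReal H * ∫⁻ y in B, ∫⁻ t in Set.Ioc (0 : ℝ) 1,
        ENNReal.ofReal (t ^ Module.finrank ℝ V) * f (t * H, t • y) ∂volume ∂μ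
      ≤ ∫⁻ z in K, f z ∂(volume.prod μ) := by
  -- Fubini by slices: the slice at height `t * H` contains `t • B`, and rescaling it produces the
  -- Jacobian `t ^ finrank`.
  rw [← lintegral_indicator hK, lintegral_prod _ (hf.indicator hK).aemeasurable,
    lintegral_eq_mul_lintegral_comp_smul volume hH]
  simp only [Module.finrank_self, pow_one]
  gcongr
  rw [lintegral_lintegral_swap]
  · refine le_trans ?_ (setLIntegral_le_lintegral (Set.Ioc 0 1) _)
    refine setLIntegral_mono_ae' measurableSet_Ioc (.of_forall fun t ht => ?_)
    rw [lintegral_eq_mul_lintegral_comp_smul μ ht.1, lintegral_const_mul]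
    · gcongr ENNReal.ofReal _ * ?_
      rw [← lintegral_indicator hB]
      refine lintegral_mono fun y => ?_
      refine Set.indicator_le' (g := fun y => K.indicator f (H • t, t • y))
        (fun y hy => ?_) (fun _ _ => zero_le) y
      rw [smul_eq_mul, mul_comm H, Set.indicator_of_mem (hBK t ht y hy)]
    · fun_prop
  · apply Measurable.aemeasurable
    simp only [Function.uncurry_def]
    fun_prop

/-- The map `y ↦ z + y` embeds `uᗮ` isometrically onto the hyperplane, and on the `n`-dimensional
space `uᗮ` the measure `μHE[n]` is the volume. Surface integrals thus become integrals to which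
Fubini applies. -/
theorem setLIntegral_euclideanHausdorffMeasure_of_subset_hyperplane {n : ℕ} {u : E (n + 1)}
    (hu : ‖u‖ = 1) (z : E (n + 1)) {F : Set (E (n + 1))}
    (hFu : ∀ x ∈ F, ⟪u, x - z⟫ = 0) (g : E (n + 1) → ENNReal) :
    ∫⁻ x in F, g x ∂μHE[n] = ∫⁻ y in {y : (Submodule.span ℝ {u})ᗮ | z + y ∈ F}, g (z + y) := by
  have hfr : Module.finrank ℝ (Submodule.span ℝ {u})ᗮ = n := by
    have : Fact (Module.finrank ℝ (E (n + 1)) = n + 1) := ⟨by simp⟩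
    exact Submodule.finrank_orthogonal_span_singleton (by rintro rfl; simp at hu)
  have hj : Isometry fun y : (Submodule.span ℝ {u})ᗮ => z + (y : E (n + 1)) :=
    (IsometryEquiv.addLeft z).isometry.comp isometry_subtype_coe
  have hje := hj.isClosedEmbedding.measurableEmbedding
  have hmap := hj.map_euclideanHausdorffMeasure (d := n)
  have hvol : (μHE[n] : Measure (Submodule.span ℝ {u})ᗮ) = volume := by
    have h := InnerProductSpace.euclideanHausdorffMeasure_eq_volume
      (V := (Submodule.span ℝ {u})ᗮ)
    rwa [hfr] at h
  have hsub : F ⊆ Set.range fun y : (Submodule.span ℝ {u})ᗮ => z + (y : E (n + 1)) := fun x hx =>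
    ⟨⟨x - z, Submodule.mem_orthogonal_singleton_iff_inner_right.2 (hFu x hx)⟩, by simp⟩
  rw [← Measure.restrict_restrict_of_subset hsub, ← hmap, hje.restrict_map, hje.lintegral_map, hvol]
  rfl

/-! ### Polytopes and their facets -/

namespace ViscousDG

theorem IsSolidPolytope.isCompact {d : ℕ} {K : Set (E d)} (hK : IsSolidPolytope K) :
    IsCompact K := by
  obtain ⟨⟨s, hs, rfl⟩, -⟩ := hK
  exact hs.isCompact_convexHull ℝ

theorem IsSolidPolytope.convex {d : ℕ} {K : Set (E d)} (hK : IsSolidPolytope K) :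
    Convex ℝ K := by
  obtain ⟨⟨s, hs, rfl⟩, -⟩ := hK
  exact convex_convexHull ℝ s

theorem IsFacet.isCompact {d : ℕ} {K F : Set (E d)} (hF : IsFacet K F) (hK : IsCompact K) :
    IsCompact F :=
  hF.2.1.isCompact hK

theorem IsFacet.exists_unit_normal {d : ℕ} {K F : Set (E d)} (hF : IsFacet K F)
    (hK : (interior K).Nonempty) :
    ∃ (u : E d) (c : ℝ), ‖u‖ = 1 ∧ (∀ x ∈ F, ⟪u, x⟫ = c) ∧ ∀ x ∈ K, ⟪u, x⟫ ≤ c := by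
  obtain ⟨⟨x₁, hx₁⟩, hexp, hdim⟩ := hF
  obtain ⟨l, hl⟩ := hexp ⟨x₁, hx₁⟩
  let a := (InnerProductSpace.toDual ℝ (E d)).symm l
  have ha (x) : ⟪a, x⟫ = l x := InnerProductSpace.toDual_symm_apply
  -- A zero functional would expose all of `K`, which has full dimension `d` instead of `d - 1`.
  have ha0 : a ≠ 0 := by
    intro h0
    have hFK : F = K := by
      rw [hl]; ext x
      simp [← ha, h0]
    have htop : affineSpan ℝ K = ⊤ := by
      refine top_unique ?_
      rw [← isOpen_interior.affineSpan_eq_top hK]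
      exact affineSpan_mono ℝ interior_subset
    rw [hFK, ← direction_affineSpan, htop, AffineSubspace.direction_top, finrank_top] at hdim
    simp at hdim
  have hmax (x) (hx : x ∈ F) (y) (hy : y ∈ K) : l y ≤ l x := by
    rw [hl] at hx; exact hx.2 y hy
  have hFK (x) (hx : x ∈ F) : x ∈ K := by rw [hl] at hx; exact hx.1
  refine ⟨‖a‖⁻¹ • a, ‖a‖⁻¹ * l x₁, by simp [norm_smul, ha0], fun x hx => ?_, fun x hx => ?_⟩
  · rw [real_inner_smul_left, ha,
      le_antisymm (hmax x₁ hx₁ x (hFK x hx)) (hmax x hx x₁ (hFK x₁ hx₁))]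
  · rw [real_inner_smul_left, ha]
    gcongr
    exact hmax x₁ hx₁ x hx

/-- A facet is a compact piece of a hyperplane, where surface measure is Lebesgue measure.
Finiteness is what makes continuous functions integrable on faces. -/
theorem IsFacet.measure_lt_top {d : ℕ} {K F : Set (E d)} (hd : d ≠ 0) (hF : IsFacet K F)
    (hK : IsSolidPolytope K) : μHE[d - 1] F < ⊤ := by
  obtain ⟨n, rfl⟩ := Nat.exists_eq_succ_of_ne_zero hd
  obtain ⟨u, c, hu, huF, -⟩ := hF.exists_unit_normal hK.2
  obtain ⟨z, hz⟩ := hF.1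
  have h := setLIntegral_euclideanHausdorffMeasure_of_subset_hyperplane hu z
    (F := F) (fun x hx => by rw [inner_sub_right, huF x hx, huF z hz, sub_self]) 1
  simp only [Pi.one_apply, setLIntegral_one] at h
  simp only [Nat.succ_eq_add_one, Nat.add_sub_cancel]
  rw [h]
  have hj : Isometry fun y : (Submodule.span ℝ {u})ᗮ => z + (y : E (n + 1)) :=
    (IsometryEquiv.addLeft z).isometry.comp isometry_subtype_coe
  exact (hj.isClosedEmbedding.isCompact_preimage (hF.isCompact hK.isCompact)).measure_lt_top

/-! ### The discrete trace inequality -/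

theorem continuous_eval_polynomial {d : ℕ} (p : MvPolynomial (Fin d) ℝ) :
    Continuous fun x : E d => MvPolynomial.eval (fun i => x i) p :=
  (MvPolynomial.continuous_eval p).comp (by fun_prop)

theorem exists_polynomial_restrict_line {d : ℕ} (p : MvPolynomial (Fin d) ℝ) (x v : E d) :
    ∃ q : Polynomial ℝ, q.natDegree ≤ p.totalDegree ∧
      ∀ t : ℝ, q.eval t = MvPolynomial.eval (fun i => (x + t • v) i) p := by
  refine ⟨MvPolynomial.aeval
    (fun i => Polynomial.C (v i) * Polynomial.X + Polynomial.C (x i)) p, ?_, fun t => ?_⟩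
  · have h := MvPolynomial.aeval_natDegree_le p le_rfl
      (fun i => Polynomial.C (v i) * Polynomial.X + Polynomial.C (x i))
      (fun i => Polynomial.natDegree_linear_le)
    rwa [mul_one] at h
  · rw [← Polynomial.coe_evalRingHom, MvPolynomial.aeval_def, MvPolynomial.hom_eval₂]
    rw [MvPolynomial.eval, MvPolynomial.coe_eval₂Hom]
    congr 1
    · ext; simp
    · ext i; simp; ring

/-- The trace inequality on a facet of a convex body that contains a ball of radius `r`. -/
theorem exists_trace_const (n m : ℕ) : ∃ C : ℝ, 0 < C ∧ ∀ (K F : Set (E (n + 1))),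
    IsSolidPolytope K → IsFacet K F → ∀ (z : E (n + 1)) (r : ℝ), 0 < r →
      Metric.closedBall z r ⊆ K → ∀ p : MvPolynomial (Fin (n + 1)) ℝ, p.totalDegree ≤ m →
      r * ∫ x in F, (MvPolynomial.eval (fun i => x i) p) ^ 2 ∂μHE[n]
        ≤ C * ∫ x in K, (MvPolynomial.eval (fun i => x i) p) ^ 2 := by
  obtain ⟨C, hC, hCq⟩ := exists_sq_eval_one_le_integral m n
  refine ⟨C, hC, fun K F hK hF z r hr hball p hp => ?_⟩
  obtain ⟨u, c, hu, huF, huK⟩ := hF.exists_unit_normal hK.2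
  have huu : ⟪u, u⟫ = 1 := by rw [real_inner_self_eq_norm_sq, hu, one_pow]
  -- The height of the cone with apex `z` over `F`; it is at least `r` because `z + r • u` lies in
  -- the ball, hence in `K`.
  let H := c - ⟪u, z⟫
  have hrH : r ≤ H := by
    have h := huK (z + r • u) (hball (by simp [norm_smul, hu, abs_of_pos hr]))
    rw [inner_add_right, real_inner_smul_right, huu] at h
    simp only [H]; linarith
  have hH : 0 < H := hr.trans_le hrH
  have hzK : z ∈ K := hball (Metric.mem_closedBall_self hr.le)
  let S := Submodule.span ℝ {u}
  have hfr : Module.finrank ℝ Sᗮ = n := by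
    have : Fact (Module.finrank ℝ (E (n + 1)) = n + 1) := ⟨by simp⟩
    exact Submodule.finrank_orthogonal_span_singleton (by rintro rfl; simp at hu)
  let g : E (n + 1) → ℝ := fun x => (MvPolynomial.eval (fun i => x i) p) ^ 2
  have hg : Continuous g := (continuous_eval_polynomial p).pow 2
  -- Orthonormal coordinates centred at `z`: height along `u`, and position in `uᗮ`.
  let Φ : ℝ × Sᗮ → E (n + 1) := fun w => z + w.1 • u + w.2
  have hΦc : Continuous Φ := by simp only [Φ]; fun_prop
  have hΦ : MeasurePreserving Φ (volume.prod volume) volume := by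
    have h1 : MeasurePreserving (Prod.map (LinearIsometryEquiv.toSpanUnitSingleton (𝕜 := ℝ) u hu)
        (id : Sᗮ → Sᗮ)) (volume.prod volume) (volume.prod volume) :=
      (LinearIsometryEquiv.measurePreserving _).prod (.id _)
    have h2 := (S.measurePreserving_measurableEquivProd z).symm
    rw [InnerProductSpace.euclideanHausdorffMeasure_eq_volume] at h2
    have h3 : Φ = (S.measurableEquivProd z).symm ∘
        Prod.map (LinearIsometryEquiv.toSpanUnitSingleton (𝕜 := ℝ) u hu) (id : Sᗮ → Sᗮ) := by
      funext w
      simp [Φ, add_assoc, add_comm z]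
    rw [h3]
    exact h2.comp h1
  have hB : MeasurableSet {y : Sᗮ | (z + H • u) + y ∈ F} :=
    (hF.isCompact hK.isCompact).isClosed.measurableSet.preimage
      (by fun_prop : Continuous fun y : Sᗮ => (z + H • u) + (y : E (n + 1))).measurable
  have hcone := lintegral_cone_le (volume : Measure Sᗮ) hH
    (f := fun w => ENNReal.ofReal (g (Φ w))) (by fun_prop) hB
    (K := Φ ⁻¹' K) (hK.isCompact.isClosed.measurableSet.preimage hΦc.measurable) (by
      intro t ht y hy
      have h := hK.convex.add_smul_sub_mem hzK (hF.2.1.subset hy) ⟨ht.1.le, ht.2⟩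
      have h1 : Φ (t * H, t • y) = z + t • (z + H • u + y - z) := by
        simp only [Φ, Submodule.coe_smul]
        module
      rwa [Set.mem_preimage, h1])
  rw [hfr] at hcone
  have hKint : ∫⁻ w in Φ ⁻¹' K, ENNReal.ofReal (g (Φ w)) ∂(volume.prod volume)
      = ∫⁻ x in K, ENNReal.ofReal (g x) :=
    hΦ.setLIntegral_comp_preimage hK.isCompact.isClosed.measurableSet
      hg.measurable.ennreal_ofReal
  have hFint := setLIntegral_euclideanHausdorffMeasure_of_subset_hyperplane hu (z + H • u)
    (F := F) (fun x hx => by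
      rw [inner_sub_right, inner_add_right, real_inner_smul_right, huu, huF x hx]
      simp only [H]; ring) (fun x => ENNReal.ofReal (g x))
  have hline (y : Sᗮ) : ENNReal.ofReal (g ((z + H • u) + y)) ≤ ENNReal.ofReal C *
      ∫⁻ t in Set.Ioc (0 : ℝ) 1, ENNReal.ofReal (t ^ n) *
        ENNReal.ofReal (g (Φ (t * H, t • y))) := by
    obtain ⟨q, hqd, hq⟩ := exists_polynomial_restrict_line p z (H • u + y)
    have hqt (t : ℝ) : g (Φ (t * H, t • y)) = (q.eval t) ^ 2 := by
      have h1 : Φ (t * H, t • y) = z + t • (H • u + y) := by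
        simp only [Φ, Submodule.coe_smul]
        module
      simp only [hq, g, h1]
    have h1 : g ((z + H • u) + y) = (q.eval 1) ^ 2 := by
      simp only [hq, g, one_smul, add_assoc]
    rw [h1]
    refine (ENNReal.ofReal_le_ofReal (hCq q (hqd.trans hp))).trans ?_
    rw [ENNReal.ofReal_mul hC.le, intervalIntegral.integral_of_le zero_le_one,
      ofReal_integral_eq_lintegral_ofReal]
    · gcongr ENNReal.ofReal C * ?_
      refine setLIntegral_mono' measurableSet_Ioc fun t ht => ?_
      rw [hqt, ENNReal.ofReal_mul (pow_nonneg ht.1.le _)]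
    · exact (Continuous.integrableOn_Ioc (by fun_prop))
    · refine (ae_restrict_iff' measurableSet_Ioc).2 (.of_forall fun t ht => ?_)
      exact mul_nonneg (pow_nonneg ht.1.le _) (sq_nonneg _)
  have hmain : ENNReal.ofReal r * ∫⁻ x in F, ENNReal.ofReal (g x) ∂μHE[n]
      ≤ ENNReal.ofReal C * ∫⁻ x in K, ENNReal.ofReal (g x) := by
    rw [← hKint, hFint]
    refine le_trans ?_ (mul_le_mul_right hcone _)
    rw [mul_left_comm]
    refine mul_le_mul' (ENNReal.ofReal_le_ofReal hrH) ?_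
    rw [← lintegral_const_mul' _ _ ENNReal.ofReal_ne_top]
    exact lintegral_mono fun y => hline y
  have hgK : IntegrableOn g K := hg.continuousOn.integrableOn_compact hK.isCompact
  have hg0 : ∀ x, 0 ≤ g x := fun x => sq_nonneg _
  rw [← ofReal_integral_eq_lintegral_ofReal hgK (.of_forall hg0),
    ← ENNReal.ofReal_mul hC.le] at hmain
  have hreal := ENNReal.toReal_le_of_le_ofReal
    (mul_nonneg hC.le (integral_nonneg hg0)) hmain
  rwa [ENNReal.toReal_mul, ENNReal.toReal_ofReal hr.le,
    ← integral_eq_lintegral_of_nonneg_ae (.of_forall hg0) hg.aestronglyMeasurable] at hreal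

theorem Mesh.exists_isDiscreteTraceConst {d : ℕ} (hd : d ≠ 0) (m : ℕ) (ρ : ℝ) :
    ∃ Ctr : ℝ, 0 < Ctr ∧ ∀ (Ω : Set (E d)) (T : Mesh d Ω),
      T.IsShapeRegular ρ → T.IsDiscreteTraceConst m Ctr := by
  obtain ⟨n, rfl⟩ := Nat.exists_eq_succ_of_ne_zero hd
  obtain ⟨C, hC, hCp⟩ := exists_trace_const n m
  -- The maximum with `1` keeps the constant positive when `ρ ≤ 0`.
  refine ⟨√(C * max ρ 1), by positivity, fun Ω T hT K F hF p hp => ?_⟩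
  obtain ⟨z, r, hr, hball, hdiam⟩ := hT K
  have h := hCp K.1 F.1 (T.isSolidPolytope K.1 K.2) hF z r hr hball p hp
  rw [← Real.sqrt_mul Metric.diam_nonneg, ← Real.sqrt_mul (by positivity)]
  refine Real.sqrt_le_sqrt ?_
  have h0 : 0 ≤ ∫ x in F.1, (MvPolynomial.eval (fun i => x i) p) ^ 2 ∂μHE[n] :=
    integral_nonneg fun _ => sq_nonneg _
  calc Metric.diam K.1 * ∫ x in F.1, (MvPolynomial.eval (fun i => x i) p) ^ 2 ∂μHE[n]
      ≤ (max ρ 1 * r) * ∫ x in F.1, (MvPolynomial.eval (fun i => x i) p) ^ 2 ∂μHE[n] := by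
        gcongr
        exact hdiam.trans (by gcongr; exact le_max_left _ _)
    _ ≤ max ρ 1 * (C * ∫ x in K.1, (MvPolynomial.eval (fun i => x i) p) ^ 2) := by
        rw [mul_assoc]; gcongr
    _ = _ := by ring

end ViscousDG

/-! ### Broken derivatives of piecewise polynomials -/

theorem MvPolynomial.totalDegree_pderiv_le {σ R : Type*} [CommSemiring R] (i : σ)
    (p : MvPolynomial σ R) : (pderiv i p).totalDegree ≤ p.totalDegree := by
  conv_lhs => rw [p.as_sum, map_sum]
  refine totalDegree_finsetSum_le fun s hs => ?_
  rw [pderiv_monomial]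
  refine (totalDegree_monomial_le _ _).trans (le_trans ?_ (le_totalDegree hs))
  exact Finsupp.degree_mono (tsub_le_self : s - Finsupp.single i 1 ≤ s)

theorem MeasureTheory.integrableOn_of_continuousOn_isCompact {X : Type*} [TopologicalSpace X]
    [T2Space X] [MeasurableSpace X] [BorelSpace X] {μ : Measure X} {F : Set X}
    (hF : IsCompact F) (hμ : μ F < ⊤) {f : X → ℝ} (hf : ContinuousOn f F) :
    IntegrableOn f F μ := by
  obtain ⟨M, hM⟩ := hF.exists_bound_of_continuousOn hf
  have : IsFiniteMeasure (μ.restrict F) := ⟨by simpa using hμ⟩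
  exact Integrable.of_bound (hf.aestronglyMeasurable_of_isCompact hF hF.measurableSet) M
    ((ae_restrict_iff' hF.measurableSet).2 (.of_forall hM))

namespace ViscousDG

theorem hasFDerivAt_eval_polynomial {d : ℕ} (p : MvPolynomial (Fin d) ℝ) (x : E d) :
    HasFDerivAt (fun y : E d => MvPolynomial.eval (fun i => y i) p)
      (∑ j, MvPolynomial.eval (fun i => x i) (MvPolynomial.pderiv j p) •
        (EuclideanSpace.proj j : E d →L[ℝ] ℝ)) x := by
  induction p using MvPolynomial.induction_on with
  | C a => simpa using hasFDerivAt_const a x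
  | add p q hp hq =>
    simp only [map_add, add_smul, Finset.sum_add_distrib]
    exact hp.add hq
  | mul_X p i hp =>
    have hi : HasFDerivAt (fun y : E d => y i) (EuclideanSpace.proj i : E d →L[ℝ] ℝ) x :=
      (EuclideanSpace.proj i : E d →L[ℝ] ℝ).hasFDerivAt
    have h := hp.mul hi
    simp only [map_mul, MvPolynomial.eval_X]
    refine h.congr_fderiv ?_
    ext v
    simp [Derivation.leibniz, MvPolynomial.pderiv_X, add_mul, Finset.sum_add_distrib,
      Finset.mul_sum, Pi.single_apply, apply_ite, mul_assoc, Finset.sum_ite_eq]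

/-- The functions that agree on `K` with a polynomial of degree at most `m`. -/
def polyOn {d : ℕ} (m : ℕ) (K : Set (E d)) : Submodule ℝ (E d → ℝ) where
  carrier := {f | ∃ p : MvPolynomial (Fin d) ℝ, p.totalDegree ≤ m ∧
    ∀ x ∈ K, f x = MvPolynomial.eval (fun j => x j) p}
  zero_mem' := ⟨0, by simp, by simp⟩
  add_mem' := by
    rintro f g ⟨p, hp, hpf⟩ ⟨q, hq, hqg⟩
    exact ⟨p + q, (MvPolynomial.totalDegree_add p q).trans (max_le hp hq),
      fun x hx => by simp [hpf x hx, hqg x hx]⟩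
  smul_mem' := by
    rintro c f ⟨p, hp, hpf⟩
    exact ⟨c • p, (MvPolynomial.totalDegree_smul_le c p).trans hp,
      fun x hx => by simp [hpf x hx, MvPolynomial.smul_eval]⟩

theorem continuousOn_of_mem_polyOn {d m : ℕ} {K : Set (E d)} {f : E d → ℝ}
    (hf : f ∈ polyOn m K) : ContinuousOn f K := by
  obtain ⟨p, -, hp⟩ := hf
  exact (continuous_eval_polynomial p).continuousOn.congr hp

namespace Mesh

variable {d : ℕ} {Ω : Set (E d)} {T : Mesh d Ω} {m : ℕ} {w : T.BrokenField}

/-- A convex set with nonempty interior has unique derivatives up to its boundary, so `fderivWithin`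
on `K` is the derivative of the polynomial extension, also on the faces. -/
theorem grad_mem_polyOn (hw : w ∈ T.brokenPoly m) (K : T.Elem) (i j : Fin d) :
    (fun x => grad w K x i j) ∈ polyOn m K.1 := by
  choose p hp hpw using hw K
  refine ⟨MvPolynomial.pderiv j (p i), (MvPolynomial.totalDegree_pderiv_le j _).trans (hp i),
    fun x hx => ?_⟩
  have hK := T.isSolidPolytope K.1 K.2
  let W : E d → E d := fun x => WithLp.toLp 2 fun i => MvPolynomial.eval (fun j => x j) (p i)
  have hW : HasFDerivAt W ((PiLp.continuousLinearEquiv 2 ℝ (fun _ : Fin d => ℝ)).symm.toContinuousLinearMap.comp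
      (ContinuousLinearMap.pi fun i => ∑ j,
        MvPolynomial.eval (fun i => x i) (MvPolynomial.pderiv j (p i)) •
        (EuclideanSpace.proj j : E d →L[ℝ] ℝ))) x := by
    rw [← hasFDerivWithinAt_univ, hasFDerivWithinAt_euclidean]
    intro i
    rw [hasFDerivWithinAt_univ]
    refine (hasFDerivAt_eval_polynomial (p i) x).congr_fderiv ?_
    ext v
    simp
  have hwW : ∀ y ∈ K.1, w K y = W y := fun y hy => by
    ext i; exact hpw i y hy
  have h : fderivWithin ℝ (w K) K.1 x = _ :=
    (hW.hasFDerivWithinAt.congr hwW (hwW x hx)).fderivWithin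
      (uniqueDiffOn_convex hK.convex hK.2 x hx)
  simp [grad, h]

theorem stress_mem_polyOn (hw : w ∈ T.brokenPoly m) (K : T.Elem) (i j : Fin d) :
    (fun x => stress w K x i j) ∈ polyOn m K.1 := by
  have hdiv : (fun x => divergence w K x) ∈ polyOn m K.1 := by
    have h := Submodule.sum_mem (polyOn m K.1) (t := Finset.univ)
      (fun i _ => grad_mem_polyOn hw K i i)
    convert h using 1
    ext x
    simp [divergence, Matrix.trace]
  have h := Submodule.sub_mem _ (Submodule.add_mem _ (grad_mem_polyOn hw K i j)
    (grad_mem_polyOn hw K j i)) (Submodule.smul_mem _ ((2 / 3 : ℝ) *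
      (1 : Matrix (Fin d) (Fin d) ℝ) i j) hdiv)
  convert h using 1
  ext x
  simp [stress]
  ring

end Mesh
end ViscousDG

/-! ### Pointwise algebra and the coercivity constant -/

namespace ViscousDG

open Mesh

theorem frob_self_nonneg {d : ℕ} (A : Matrix (Fin d) (Fin d) ℝ) : 0 ≤ frob A A :=
  Finset.sum_nonneg fun _ _ => Finset.sum_nonneg fun _ _ => mul_self_nonneg _

theorem frob_half_smul_add_le {d : ℕ} (A B : Matrix (Fin d) (Fin d) ℝ) :
    frob ((1 / 2 : ℝ) • (A + B)) ((1 / 2 : ℝ) • (A + B)) ≤ (frob A A + frob B B) / 2 := by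
  simp only [frob, ← Finset.sum_add_distrib, Finset.sum_div]
  gcongr with i _ j _
  simp only [Matrix.smul_apply, Matrix.add_apply, smul_eq_mul]
  nlinarith [sq_nonneg (A i j - B i j)]

theorem norm_sq_mulVec_le_frob {d : ℕ} (A : Matrix (Fin d) (Fin d) ℝ) (v : E d) :
    ‖(WithLp.toLp 2 (A.mulVec (WithLp.ofLp v)) : E d)‖ ^ 2 ≤ frob A A * ‖v‖ ^ 2 := by
  simp only [EuclideanSpace.norm_sq_eq, frob, Finset.sum_mul, Real.norm_eq_abs, sq_abs]
  gcongr with i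
  simp only [Matrix.mulVec, dotProduct]
  refine (Finset.sum_mul_sq_le_sq_mul_sq _ _ _).trans_eq ?_
  simp only [← sq, Finset.sum_mul]

/-- The viscous stress dissipates: `S : G ≥ |S|² / 2` for `S = G + Gᵀ - (2/3) (tr G) 𝕀`. -/
theorem half_frob_stress_le {d : ℕ} (hd : d = 2 ∨ d = 3) (G : Matrix (Fin d) (Fin d) ℝ) :
    (1 / 2) * frob (G + G.transpose - ((2 / 3 : ℝ) * G.trace) • 1)
        (G + G.transpose - ((2 / 3 : ℝ) * G.trace) • 1)
      ≤ frob (G + G.transpose - ((2 / 3 : ℝ) * G.trace) • 1) G := by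
  -- The difference of the two sides is `(2 / 9) * (3 - d) * (tr G) ^ 2`, which vanishes for `d =
  -- 3`.
  rcases hd with rfl | rfl
  · simp [frob, Fin.sum_univ_two, Matrix.trace, Matrix.one_apply]
    nlinarith [sq_nonneg (G 0 0 + G 1 1)]
  · simp [frob, Fin.sum_univ_three, Matrix.trace, Matrix.one_apply]
    nlinarith [sq_nonneg (G 0 0 + G 1 1 + G 2 2)]

theorem IsFacet.diam_pos {d : ℕ} (hd : 2 ≤ d) {K F : Set (E d)} (hF : IsFacet K F)
    (hK : IsCompact K) : 0 < Metric.diam F := by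
  refine Metric.diam_nonneg.lt_of_ne fun h0 => ?_
  have hsub : F.Subsingleton := fun x hx y hy => by
    have h := Metric.dist_le_diam_of_mem (hF.isCompact hK).isBounded hx hy
    rw [← h0] at h
    exact dist_le_zero.1 h
  have h := hF.2.2
  rw [vectorSpan_of_subsingleton ℝ hsub, finrank_bot] at h
  omega

theorem two_mul_inner_le {V : Type*} [NormedAddCommGroup V] [InnerProductSpace ℝ V] (x y : V)
    {δ : ℝ} (hδ : 0 < δ) : 2 * ⟪x, y⟫ ≤ δ * ‖y‖ ^ 2 + δ⁻¹ * ‖x‖ ^ 2 := by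
  have h := real_inner_le_norm x y
  have h1 : 0 ≤ δ⁻¹ * (δ * ‖y‖ - ‖x‖) ^ 2 := by positivity
  have h2 : δ⁻¹ * (δ * ‖y‖ - ‖x‖) ^ 2
      = δ * ‖y‖ ^ 2 + δ⁻¹ * ‖x‖ ^ 2 - 2 * (‖x‖ * ‖y‖) := by
    field_simp
    ring
  linarith

theorem coercivity_const_le {η T a b V X : ℝ} (hT : 0 ≤ T) (hη : 2 * T < η) (ha : 0 ≤ a)
    (hX : ∀ ε : ℝ, 0 < ε → 2 * X ≤ ε * (T * a) + ε⁻¹ * b) (hV : a / 2 - 2 * X + η * b ≤ V) :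
    (η - 2 * T) / (1 + 2 * η) * (a + b) ≤ V := by
  have h1 : 0 < 1 + 2 * η := by linarith
  have hη0 : 0 < η := by linarith
  have hD : 0 < η ^ 2 + T := by positivity
  -- This `ε` solves `η - ε⁻¹ = C`, so `b` gets exactly the coefficient `C`; the surplus over `C` in
  -- the coefficient of `a` is then a square over a positive number.
  have h := hX ((1 + 2 * η) / (2 * (η ^ 2 + T))) (by positivity)
  rw [inv_div] at h
  have h2 : 2 * (η ^ 2 + T) / (1 + 2 * η) = η - (η - 2 * T) / (1 + 2 * η) := by
    field_simp; ring
  have h3 : (η - 2 * T) / (1 + 2 * η) ≤ 1 / 2 - (1 + 2 * η) / (2 * (η ^ 2 + T)) * T := by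
    rw [← sub_nonneg]
    have : 1 / 2 - (1 + 2 * η) / (2 * (η ^ 2 + T)) * T - (η - 2 * T) / (1 + 2 * η)
        = (η - 2 * T) ^ 2 / (2 * (η ^ 2 + T) * (1 + 2 * η)) := by
      field_simp; ring
    rw [this]
    positivity
  rw [h2] at h
  nlinarith [mul_le_mul_of_nonneg_right h3 ha]

/-! ### Estimates on faces, and coercivity -/

namespace Mesh

variable {d : ℕ} {Ω : Set (E d)} {T : Mesh d Ω} {m : ℕ} {w : T.BrokenField}

theorem isFacet_plus (F : T.Face) : IsFacet (T.plus F).1 F.1 :=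
  (T.isFacet_iff F _).2 (.inl rfl)

theorem isFacet_minus {F : T.Face} {K : T.Elem} (h : T.minus F = some K) : IsFacet K.1 F.1 :=
  (T.isFacet_iff F K).2 (.inr h)

theorem isCompact_elem (K : T.Elem) : IsCompact K.1 := (T.isSolidPolytope K.1 K.2).isCompact

theorem isCompact_face (F : T.Face) : IsCompact F.1 :=
  (isFacet_plus F).isCompact (isCompact_elem _)

theorem continuousOn_field (hw : w ∈ T.brokenPoly m) (K : T.Elem) : ContinuousOn (w K) K.1 := by
  have h : ContinuousOn (fun x => WithLp.ofLp (w K x)) K.1 :=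
    continuousOn_pi.2 fun i => continuousOn_of_mem_polyOn (m := m) (hw K i)
  exact (PiLp.continuous_toLp 2 _).comp_continuousOn h

theorem continuousOn_stress (hw : w ∈ T.brokenPoly m) (K : T.Elem) :
    ContinuousOn (stress w K) K.1 :=
  continuousOn_pi.2 fun i => continuousOn_pi.2 fun j =>
    continuousOn_of_mem_polyOn (stress_mem_polyOn hw K i j)

theorem continuousOn_jump (hw : w ∈ T.brokenPoly m) (F : T.Face) :
    ContinuousOn (jump w F) F.1 := by
  have h1 := (continuousOn_field hw (T.plus F)).mono (isFacet_plus F).2.1.subset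
  rcases h : T.minus F with _ | K
  · have : jump w F = w (T.plus F) := by funext x; simp [jump, h]
    rwa [this]
  · have : jump w F = fun x => w (T.plus F) x - w K x := by funext x; simp [jump, h]
    rw [this]
    exact h1.sub ((continuousOn_field hw K).mono (isFacet_minus h).2.1.subset)

theorem continuousOn_avgStress (hw : w ∈ T.brokenPoly m) (F : T.Face) :
    ContinuousOn (avgStress w F) F.1 := by
  have h1 := (continuousOn_stress hw (T.plus F)).mono (isFacet_plus F).2.1.subset
  rcases h : T.minus F with _ | K
  · have : avgStress w F = stress w (T.plus F) := by funext x; simp [avgStress, h]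
    rwa [this]
  · have : avgStress w F = fun x => (1 / 2 : ℝ) • (stress w (T.plus F) x + stress w K x) := by
      funext x; simp [avgStress, h]
    rw [this]
    exact (h1.add ((continuousOn_stress hw K).mono (isFacet_minus h).2.1.subset)).const_smul
      (1 / 2 : ℝ)

theorem continuousOn_avgTraction (hw : w ∈ T.brokenPoly m) (F : T.Face) :
    ContinuousOn (avgTraction w F) F.1 := by
  refine (PiLp.continuous_toLp 2 _).comp_continuousOn ?_
  have : Continuous fun A : Matrix (Fin d) (Fin d) ℝ => A.mulVec (WithLp.ofLp (T.normal F)) := by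
    fun_prop
  exact this.comp_continuousOn (continuousOn_avgStress hw F)

theorem continuousOn_frob_stress (hw : w ∈ T.brokenPoly m) (K : T.Elem) :
    ContinuousOn (fun x => frob (stress w K x) (stress w K x)) K.1 := by
  have : Continuous fun A : Matrix (Fin d) (Fin d) ℝ => frob A A := by
    simp only [frob]; fun_prop
  exact this.comp_continuousOn (continuousOn_stress hw K)

theorem continuousOn_frob_stress_grad (hw : w ∈ T.brokenPoly m) (K : T.Elem) :
    ContinuousOn (fun x => frob (stress w K x) (grad w K x)) K.1 := by
  refine continuousOn_finsetSum _ fun i _ => continuousOn_finsetSum _ fun j _ => ?_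
  exact (continuousOn_of_mem_polyOn (stress_mem_polyOn hw K i j)).mul
    (continuousOn_of_mem_polyOn (grad_mem_polyOn hw K i j))

-- Summing over all elements adjacent to `F` treats boundary and interior faces alike and prepares
-- the exchange of the sums over faces and elements.
open Classical in
theorem norm_sq_avgTraction_le (F : T.Face) (x : E d) :
    ‖avgTraction w F x‖ ^ 2 ≤
      ∑ K : T.Elem, if IsFacet K.1 F.1 then frob (stress w K x) (stress w K x) else 0 := by
  have hle (K : T.Elem) (hK : IsFacet K.1 F.1) : frob (stress w K x) (stress w K x) ≤
      ∑ K : T.Elem, if IsFacet K.1 F.1 then frob (stress w K x) (stress w K x) else 0 := by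
    have h := Finset.single_le_sum
      (f := fun K : T.Elem => if IsFacet K.1 F.1 then frob (stress w K x) (stress w K x) else 0)
      (fun K _ => by
        split_ifs
        exacts [frob_self_nonneg _, le_rfl]) (Finset.mem_univ K)
    rwa [if_pos hK] at h
  have h1 := norm_sq_mulVec_le_frob (avgStress w F x) (T.normal F)
  rw [T.norm_normal, one_pow, mul_one] at h1
  refine h1.trans ?_
  rcases h : T.minus F with _ | K
  · simpa [avgStress, h] using hle _ (isFacet_plus F)
  · have h2 := frob_half_smul_add_le (stress w (T.plus F) x) (stress w K x)
    have h3 := hle _ (isFacet_plus F)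
    have h4 := hle _ (isFacet_minus h)
    simp only [avgStress, h]
    linarith

theorem diam_mul_integral_sq_le {Ctr : ℝ} (hT : T.IsDiscreteTraceConst m Ctr) {K : T.Elem}
    {F : T.Face} (hF : IsFacet K.1 F.1) {f : E d → ℝ} (hf : f ∈ polyOn m K.1) :
    Metric.diam K.1 * ∫ x in F.1, f x * f x ∂μHE[d - 1] ≤ Ctr ^ 2 * ∫ x in K.1, f x * f x := by
  obtain ⟨p, hp, hfp⟩ := hf
  have h := pow_le_pow_left₀ (by positivity) (hT K F hF p hp) 2
  rw [mul_pow, mul_pow, Real.sq_sqrt Metric.diam_nonneg,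
    Real.sq_sqrt (integral_nonneg fun _ => sq_nonneg _),
    Real.sq_sqrt (integral_nonneg fun _ => sq_nonneg _)] at h
  rw [setIntegral_congr_fun (isCompact_face F).measurableSet
      (fun x hx => by rw [hfp x (hF.2.1.subset hx), ← sq]),
    setIntegral_congr_fun (isCompact_elem K).measurableSet
      (fun x hx => by rw [hfp x hx, ← sq])]
  exact h

theorem integrableOn_face (hd : d ≠ 0) {F : T.Face} {f : E d → ℝ} (hf : ContinuousOn f F.1) :
    IntegrableOn f F.1 μHE[d - 1] :=
  integrableOn_of_continuousOn_isCompact (isCompact_face F)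
    ((isFacet_plus F).measure_lt_top hd (T.isSolidPolytope _ (T.plus F).2)) hf

theorem diam_mul_integral_frob_le (hd : d ≠ 0) {Ctr : ℝ} (hT : T.IsDiscreteTraceConst m Ctr)
    (hw : w ∈ T.brokenPoly m) {K : T.Elem} {F : T.Face} (hF : IsFacet K.1 F.1) :
    Metric.diam F.1 * ∫ x in F.1, frob (stress w K x) (stress w K x) ∂μHE[d - 1]
      ≤ Ctr ^ 2 * ∫ x in K.1, frob (stress w K x) (stress w K x) := by
  have hc (i j : Fin d) : ContinuousOn (fun x => stress w K x i j * stress w K x i j) K.1 :=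
    (continuousOn_of_mem_polyOn (stress_mem_polyOn hw K i j)).mul
      (continuousOn_of_mem_polyOn (stress_mem_polyOn hw K i j))
  calc Metric.diam F.1 * ∫ x in F.1, frob (stress w K x) (stress w K x) ∂μHE[d - 1]
      -- Since `h_F ≤ h_K`, the trace inequality can be applied to each entry of the stress.
      ≤ Metric.diam K.1 * ∫ x in F.1, frob (stress w K x) (stress w K x) ∂μHE[d - 1] := by
        have := integral_nonneg (μ := (μHE[d - 1]).restrict F.1)
          (f := fun x => frob (stress w K x) (stress w K x)) (fun x => frob_self_nonneg _)
        gcongr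
        exact Metric.diam_mono hF.2.1.subset (isCompact_elem K).isBounded
    _ ≤ _ := by
      have hiF (i j : Fin d) := integrableOn_face hd ((hc i j).mono hF.2.1.subset)
      have hiK (i j : Fin d) := (hc i j).integrableOn_compact (μ := volume) (isCompact_elem K)
      simp only [frob]
      rw [integral_finsetSum _ fun i _ => integrable_finsetSum _ fun j _ => hiF i j,
        integral_finsetSum _ fun i _ => integrable_finsetSum _ fun j _ => hiK i j,
        Finset.mul_sum, Finset.mul_sum]
      refine Finset.sum_le_sum fun i _ => ?_
      rw [integral_finsetSum _ fun j _ => hiF i j, integral_finsetSum _ fun j _ => hiK i j,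
        Finset.mul_sum, Finset.mul_sum]
      exact Finset.sum_le_sum fun j _ => diam_mul_integral_sq_le hT hF (stress_mem_polyOn hw K i j)

open Classical in
theorem sum_ite_isFacet (K : T.Elem) (c : ℝ) :
    (∑ F : T.Face, if IsFacet K.1 F.1 then c else 0) = T.numFaces K * c := by
  rw [Finset.sum_coe_sort T.faces (fun F => if IsFacet K.1 F then c else 0), ← Finset.sum_filter,
    Finset.sum_const, nsmul_eq_mul, numFaces]

-- Young's inequality with weight `ε h_F`: the factor `h_F` is absorbed by the trace inequality, and
-- its inverse is the weight of the jumps in the norm.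
open Classical in
theorem two_mul_integral_jump_avgTraction_le (hd : 2 ≤ d) {Ctr : ℝ}
    (hT : T.IsDiscreteTraceConst m Ctr) (hw : w ∈ T.brokenPoly m) (F : T.Face) {ε : ℝ}
    (hε : 0 < ε) :
    2 * ∫ x in F.1, ⟪jump w F x, avgTraction w F x⟫ ∂μHE[d - 1] ≤
      ε * (∑ K : T.Elem, if IsFacet K.1 F.1 then
        Ctr ^ 2 * ∫ x in K.1, frob (stress w K x) (stress w K x) else 0)
      + ε⁻¹ * ∫ x in F.1, (1 / Metric.diam F.1) * ⟪jump w F x, jump w F x⟫ ∂μHE[d - 1] := by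
  have hd0 : d ≠ 0 := by omega
  have hh : 0 < Metric.diam F.1 := (isFacet_plus F).diam_pos hd (isCompact_elem _)
  have hJ := continuousOn_jump hw F
  have hσ := continuousOn_avgTraction hw F
  have hiJ : IntegrableOn (fun x => (1 / Metric.diam F.1) * ⟪jump w F x, jump w F x⟫) F.1
      μHE[d - 1] := integrableOn_face hd0 ((hJ.inner hJ).const_smul (1 / Metric.diam F.1))
  have hiK (K : T.Elem) : IntegrableOn (fun x => if IsFacet K.1 F.1 then
      frob (stress w K x) (stress w K x) else 0) F.1 μHE[d - 1] := by
    by_cases hK : IsFacet K.1 F.1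
    · simp only [hK, if_true]
      exact integrableOn_face hd0 ((continuousOn_frob_stress hw K).mono hK.2.1.subset)
    · simp [hK]
  have hsum := integrable_finsetSum Finset.univ fun K _ => hiK K
  calc 2 * ∫ x in F.1, ⟪jump w F x, avgTraction w F x⟫ ∂μHE[d - 1]
      = ∫ x in F.1, 2 * ⟪jump w F x, avgTraction w F x⟫ ∂μHE[d - 1] :=
        (integral_const_mul _ _).symm
    _ ≤ ∫ x in F.1, (ε * Metric.diam F.1 * (∑ K : T.Elem, if IsFacet K.1 F.1 then
          frob (stress w K x) (stress w K x) else 0)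
        + ε⁻¹ * ((1 / Metric.diam F.1) * ⟪jump w F x, jump w F x⟫)) ∂μHE[d - 1] := by
        refine integral_mono ((integrableOn_face hd0 (hJ.inner hσ)).const_mul 2)
          ((hsum.const_mul _).add (hiJ.const_mul _)) fun x => ?_
        have h := two_mul_inner_le (jump w F x) (avgTraction w F x) (mul_pos hε hh)
        refine h.trans ?_
        rw [real_inner_self_eq_norm_sq, mul_inv, one_div, ← mul_assoc]
        gcongr
        exact norm_sq_avgTraction_le F x
    _ = ε * (∑ K : T.Elem, if IsFacet K.1 F.1 then
          Metric.diam F.1 * ∫ x in F.1, frob (stress w K x) (stress w K x) ∂μHE[d - 1] else 0)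
        + ε⁻¹ * ∫ x in F.1, (1 / Metric.diam F.1) * ⟪jump w F x, jump w F x⟫ ∂μHE[d - 1] := by
        rw [integral_add (hsum.const_mul _) (hiJ.const_mul _), integral_const_mul,
          integral_const_mul, integral_finsetSum _ fun K _ => hiK K, mul_assoc, Finset.mul_sum]
        refine congrArg (fun c => ε * c + _) (Finset.sum_congr rfl fun K _ => ?_)
        split_ifs <;> simp
    _ ≤ _ := by
        gcongr with K
        split_ifs with hK
        · exact diam_mul_integral_frob_le hd0 hT hw hK
        · exact le_rfl

/-- Coercivity of the viscous form on broken polynomials. -/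
theorem coercive_viscousForm (hd : d = 2 ∨ d = 3) {Ctr η : ℝ} {N : ℕ}
    (hη : 2 * Ctr ^ 2 * N < η) (hT : T.IsDiscreteTraceConst m Ctr)
    (hN : ∀ K : T.Elem, T.numFaces K ≤ N) (hw : w ∈ T.brokenPoly m) :
    (η - 2 * Ctr ^ 2 * N) / (1 + 2 * η) * symNorm w ^ 2 ≤ viscousForm η w w := by
  classical
  have hd2 : 2 ≤ d := by omega
  have ha0 (K : T.Elem) : 0 ≤ ∫ x in K.1, frob (stress w K x) (stress w K x) :=
    integral_nonneg fun x => frob_self_nonneg _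
  have ha : 0 ≤ ∑ K : T.Elem, ∫ x in K.1, frob (stress w K x) (stress w K x) :=
    Finset.sum_nonneg fun K _ => ha0 K
  have hb : 0 ≤ ∑ F : T.Face, ∫ x in F.1,
      (1 / Metric.diam F.1) * ⟪jump w F x, jump w F x⟫ ∂μHE[d - 1] :=
    Finset.sum_nonneg fun F _ => integral_nonneg fun x =>
      mul_nonneg (one_div_nonneg.2 Metric.diam_nonneg) real_inner_self_nonneg
  rw [symNorm, Real.sq_sqrt (add_nonneg ha hb), mul_assoc 2]
  refine coercivity_const_le
    (X := ∑ F : T.Face, ∫ x in F.1, ⟪jump w F x, avgTraction w F x⟫ ∂μHE[d - 1])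
    (by positivity) (by linarith) ha (fun ε hε => ?_) ?_
  · rw [Finset.mul_sum]
    refine (Finset.sum_le_sum fun F _ =>
      two_mul_integral_jump_avgTraction_le hd2 hT hw F hε).trans ?_
    -- After the exchange of sums, each element contributes once for each of its at most `N` faces.
    rw [Finset.sum_add_distrib, ← Finset.mul_sum, ← Finset.mul_sum, Finset.sum_comm]
    simp only [sum_ite_isFacet]
    gcongr
    rw [Finset.mul_sum]
    refine Finset.sum_le_sum fun K _ => ?_
    rw [← mul_assoc, mul_comm (T.numFaces K : ℝ)]
    have h1 : (T.numFaces K : ℝ) ≤ N := by exact_mod_cast hN K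
    exact mul_le_mul_of_nonneg_right (mul_le_mul_of_nonneg_left h1 (sq_nonneg _)) (ha0 K)
  · have hS : (∑ K : T.Elem, ∫ x in K.1, frob (stress w K x) (stress w K x)) / 2
        ≤ ∑ K : T.Elem, ∫ x in K.1, frob (stress w K x) (grad w K x) := by
      rw [Finset.sum_div]
      refine Finset.sum_le_sum fun K _ => ?_
      rw [div_eq_inv_mul, ← one_div, ← integral_const_mul]
      refine setIntegral_mono_on
        (((continuousOn_frob_stress hw K).integrableOn_compact (isCompact_elem K)).const_mul _)
        ((continuousOn_frob_stress_grad hw K).integrableOn_compact (isCompact_elem K))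
        (isCompact_elem K).measurableSet fun x _ => ?_
      exact half_frob_stress_le hd (grad w K x)
    have hpen : ∑ F : T.Face, ∫ x in F.1,
        (η / Metric.diam F.1) * ⟪jump w F x, jump w F x⟫ ∂μHE[d - 1]
        = η * ∑ F : T.Face, ∫ x in F.1,
          (1 / Metric.diam F.1) * ⟪jump w F x, jump w F x⟫ ∂μHE[d - 1] := by
      rw [Finset.mul_sum]
      refine Finset.sum_congr rfl fun F _ => ?_
      rw [← integral_const_mul]
      congr! 2 with x
      ring
    rw [viscousForm, hpen]
    linarith

end Mesh
end ViscousDG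

theorem mainTheorem2 (d : ℕ) (hd : d = 2 ∨ d = 3) (m : ℕ) :
    (∀ ρ : ℝ, ∃ Ctr : ℝ, 0 < Ctr ∧ ∀ (Ω : Set (E d)) (T : Mesh d Ω),
      T.IsShapeRegular ρ → T.IsDiscreteTraceConst m Ctr) ∧
    (∀ (Ctr η : ℝ) (N : ℕ), 2 * Ctr ^ 2 * N < η →
      0 < (η - 2 * Ctr ^ 2 * N) / (1 + 2 * η) ∧
      ∀ (Ω : Set (E d)) (T : Mesh d Ω), T.IsDiscreteTraceConst m Ctr →
        (∀ K : T.Elem, T.numFaces K ≤ N) →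
        ∀ W : Submodule ℝ T.BrokenField, W ≤ T.brokenPoly m → ∀ w ∈ W,
          (η - 2 * Ctr ^ 2 * N) / (1 + 2 * η) * Mesh.symNorm w ^ 2 ≤
            Mesh.viscousForm η w w) := by
  refine ⟨Mesh.exists_isDiscreteTraceConst (by omega) m, fun Ctr η N hη => ⟨?_, ?_⟩⟩
  · have h : 0 ≤ 2 * Ctr ^ 2 * N := by positivity
    exact div_pos (by linarith) (by linarith)
  · exact fun Ω T hT hN W hW w hw => Mesh.coercive_viscousForm hd hη hT hN (hW hw)
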